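/- Let $\mathbb{K}$ be a field of characteristic zero, $l\ge 0$, $S=\mathbb{K}[x_1,\dots,x_l]$, and let $\mathcal{A}$ be a central hyperplane arrangement in $\mathbb{K}^l$, that is, a finite set of linear hyperplanes $H=\alpha_H^{-1}(0)$, where for each $H$ a homogeneous linear polynomial $\alpha_H\in S$ is fixed. Put $Q(\mathcal{A})=\prod_{H\in\mathcal{A}}\alpha_H$, let $J(\mathcal{A})\subseteq S$ be the ideal generated by $Q(\mathcal{A})$ and all its partial derivatives, and let $D(\mathcal{A})$ be the $S$-module of all $\mathbb{K}$-linear derivations $\delta$ of $S$ such that $\delta(\alpha_H)\in\langle\alpha_H\rangle$ for all $H\in\mathcal{A}$. A flat of $\mathcal{A}$ is an intersection $X=\bigcap_{H\in\mathcal{B}}H$ with $\mathcal{B}\subseteq\mathcal{A}$ (with $X=\mathbb{K}^l$ for $\mathcal{B}=\emptyset$), and $\mathcal{A}_X=\{H\in\mathcal{A}\mid X\subseteq H\}$. For a finitely generated graded $S$-module $M$ and $i\ge 0$ let $b_i(M)=\dim_{\mathbb{K}}\operatorname{Tor}_i^S(\mathbb{K},M)$, where $\mathbb{K}=S/(x_1,\dots,x_l)$,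 be the $i$-th total Betti number, i.e. the rank of the $i$-th free module in a minimal graded free resolution of $M$. Then for every flat $X$ of $\mathcal{A}$ and every $i\ge 0$, $$b_i(S/J(\mathcal{A}_X))\le b_i(S/J(\mathcal{A}))\quad\text{and}\quad b_i(D(\mathcal{A}_X))\le b_i(D(\mathcal{A})).$$ -/

import Mathlib

noncomputable section

open CategoryTheory

universe u

/-- A central hyperplane arrangement in `K ^ l`: a finite set of linear hyperplanes together with
a fixed choice, for each of them, of a linear homogeneous polynomial vanishing exactly on it.
The values of `form` outside `hyperplanes` are irrelevant. -/
structure CentralArrangement (K : Type u) [Field K] (l : ℕ) where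
  /-- the finite set of hyperplanes -/
  hyperplanes : Finset (Submodule K (Fin l → K))
  /-- each of them is a linear subspace of dimension `l - 1` -/
  finrank_add_one : ∀ H ∈ hyperplanes, Module.finrank K H + 1 = l
  /-- the fixed defining polynomials -/
  form : Submodule K (Fin l → K) → MvPolynomial (Fin l) K
  form_isHomogeneous : ∀ H ∈ hyperplanes, (form H).IsHomogeneous 1
  eval_form_eq_zero_iff : ∀ H ∈ hyperplanes, ∀ v : Fin l → K,
    MvPolynomial.eval v (form H) = 0 ↔ v ∈ H

namespace CentralArrangement

variable {K : Type u} [Field K] {l : ℕ}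

/-- The lattice of intersections `L(𝒜)`; the empty intersection is the whole space `K ^ l`. -/
def flats (A : CentralArrangement K l) : Set (Submodule K (Fin l → K)) :=
  {X | ∃ B : Finset (Submodule K (Fin l → K)), B ⊆ A.hyperplanes ∧ X = B.inf id}

open Classical in
/-- The localization `𝒜_X`, consisting of the hyperplanes of `𝒜` that contain `X`. -/
def localization (A : CentralArrangement K l) (X : Submodule K (Fin l → K)) :
    CentralArrangement K l where
  hyperplanes := A.hyperplanes.filter (fun H => X ≤ H)
  finrank_add_one H hH := A.finrank_add_one H (Finset.mem_filter.mp hH).1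
  form := A.form
  form_isHomogeneous H hH := A.form_isHomogeneous H (Finset.mem_filter.mp hH).1
  eval_form_eq_zero_iff H hH := A.eval_form_eq_zero_iff H (Finset.mem_filter.mp hH).1

/-- The defining polynomial `Q(𝒜)`, the product of the defining forms of the hyperplanes. -/
def definingPolynomial (A : CentralArrangement K l) : MvPolynomial (Fin l) K :=
  ∏ H ∈ A.hyperplanes, A.form H

/-- The Jacobian ideal `J(𝒜)`, generated by `Q(𝒜)` and all its partial derivatives. -/
def jacobianIdeal (A : CentralArrangement K l) : Ideal (MvPolynomial (Fin l) K) :=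
  Ideal.span (insert A.definingPolynomial
    (Set.range fun i : Fin l => MvPolynomial.pderiv i A.definingPolynomial))

/-- The module `D(𝒜)` of logarithmic vector fields: the polynomial derivations `δ` such that
`δ(α_H)` lies in the ideal generated by `α_H`, for every hyperplane `H` of `𝒜`. -/
def logDerivations (A : CentralArrangement K l) :
    Submodule (MvPolynomial (Fin l) K)
      (Derivation K (MvPolynomial (Fin l) K) (MvPolynomial (Fin l) K)) where
  carrier := {δ | ∀ H ∈ A.hyperplanes, δ (A.form H) ∈ Ideal.span {A.form H}}
  zero_mem' H _ := by simp
  add_mem' hδ hε H hH := by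
    simpa using Ideal.add_mem _ (hδ H hH) (hε H hH)
  smul_mem' f δ hδ H hH := by
    simpa using Ideal.mul_mem_left _ f (hδ H hH)

end CentralArrangement

/-- The residue field `K = S / (x_1, …, x_l)` as a module over `S = K[x_1, …, x_l]`. -/
abbrev residueModule (K : Type u) [Field K] (l : ℕ) : Type u :=
  MvPolynomial (Fin l) K ⧸
    Ideal.span (Set.range (MvPolynomial.X : Fin l → MvPolynomial (Fin l) K))

/-- The `i`-th total Betti number `b_i(M) = dim_K Tor_i^S(K, M)` of a module `M` over
`S = K[x_1, …, x_l]`, where `Tor_i^S(K, -)` is the `i`-th left derived functor of `K ⊗ -`.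
For `M` finitely generated and graded this is the rank of the `i`-th free module in a minimal
graded free resolution of `M`. -/
def totalBettiNumber (K : Type u) [Field K] (l : ℕ) (M : Type u) [AddCommGroup M]
    [Module (MvPolynomial (Fin l) K) M] (i : ℕ) : ℕ :=
  Module.finrank K
    ((ModuleCat.restrictScalars (algebraMap K (MvPolynomial (Fin l) K))).obj
      (((Tor (ModuleCat.{u} (MvPolynomial (Fin l) K)) i).obj
        (ModuleCat.of _ (residueModule K l))).obj (ModuleCat.of _ M)))

theorem finrank_residueModule (K : Type u) [Field K] (l : ℕ) :
    Module.finrank K (residueModule K l) = 1 := by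
  have hle : Ideal.span (Set.range (MvPolynomial.X : Fin l → MvPolynomial (Fin l) K)) ≤
      RingHom.ker (MvPolynomial.constantCoeff (σ := Fin l) (R := K)) := by
    rw [Ideal.span_le]
    rintro _ ⟨i, rfl⟩
    simp
  have hs : Function.Surjective (algebraMap K (residueModule K l)) := by
    intro x
    obtain ⟨x, rfl⟩ := Ideal.Quotient.mk_surjective x
    induction x using MvPolynomial.induction_on with
    | C a => exact ⟨a, rfl⟩
    | add p q hp hq =>
      obtain ⟨a, ha⟩ := hp
      obtain ⟨b, hb⟩ := hq
      exact ⟨a + b, by rw [map_add, map_add, ha, hb]⟩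
    | mul_X p i _ =>
      refine ⟨0, ?_⟩
      rw [map_zero, eq_comm, Ideal.Quotient.eq_zero_iff_mem]
      exact Ideal.mul_mem_left _ _ (Ideal.subset_span ⟨i, rfl⟩)
  have : Nontrivial (residueModule K l) := by
    apply Ideal.Quotient.nontrivial_iff.mpr
    intro h
    have h1 := hle (h ▸ Submodule.mem_top : (1 : MvPolynomial (Fin l) K) ∈ _)
    simp at h1
  exact (LinearEquiv.ofBijective (Algebra.linearMap K (residueModule K l))
    ⟨(algebraMap K (residueModule K l)).injective, hs⟩).finrank_eq.symm.trans
    (Module.finrank_self K)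

open MonoidalCategory in
/-- Total Betti numbers are the ranks in a minimal free resolution: if `P` is a resolution of `M`
whose differentials have image in `(x_1, …, x_l) P` and `P_i` is free of rank `n`, then
`b_i(M) = n`. -/
theorem totalBettiNumber_eq_of_minimal {K : Type u} [Field K] {l : ℕ} (M : Type u) [AddCommGroup M]
    [Module (MvPolynomial (Fin l) K) M]
    (P : ProjectiveResolution (ModuleCat.of (MvPolynomial (Fin l) K) M))
    (hmin : ∀ i j x, (P.complex.d i j).hom x ∈
      Ideal.span (Set.range (MvPolynomial.X : Fin l → MvPolynomial (Fin l) K)) •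
        (⊤ : Submodule (MvPolynomial (Fin l) K) (P.complex.X j)))
    (i n : ℕ) (e : (P.complex.X i) ≃ₗ[MvPolynomial (Fin l) K]
      (Fin n → MvPolynomial (Fin l) K)) :
    totalBettiNumber K l M i = n := by
  let F := (tensoringLeft (ModuleCat.{u} (MvPolynomial (Fin l) K))).obj
    (ModuleCat.of _ (residueModule K l))
  have h0 : ∀ i j, F.map (P.complex.d i j) = 0 := by
    intro i j
    apply ModuleCat.hom_ext
    apply TensorProduct.ext'
    intro x y
    change x ⊗ₜ[MvPolynomial (Fin l) K] ((P.complex.d i j).hom y) = 0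
    refine Submodule.smul_induction_on (hmin i j y) ?_ ?_
    · intro r hr z _
      rw [← TensorProduct.smul_tmul]
      have : r • x = 0 := by
        obtain ⟨x, rfl⟩ := Ideal.Quotient.mk_surjective x
        rw [← Ideal.Quotient.mk_eq_mk, ← Submodule.Quotient.mk_smul]
        exact (Submodule.Quotient.mk_eq_zero _).2 (Ideal.mul_mem_right _ _ hr)
      rw [this, TensorProduct.zero_tmul]
    · intro a b ha hb
      rw [TensorProduct.tmul_add, ha, hb, add_zero]
  let G := (F.mapHomologicalComplex _).obj P.complex
  have iso : ((Tor (ModuleCat.{u} (MvPolynomial (Fin l) K)) i).obj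
      (ModuleCat.of _ (residueModule K l))).obj (ModuleCat.of _ M) ≅ F.obj (P.complex.X i) :=
    P.isoLeftDerivedObj F i ≪≫
      (ShortComplex.HomologyData.ofZeros (G.sc i) (h0 _ _) (h0 _ _)).left.homologyIso
  have e1 : TensorProduct (MvPolynomial (Fin l) K) (residueModule K l) (P.complex.X i)
      ≃ₗ[MvPolynomial (Fin l) K] (Fin n → residueModule K l) :=
    (TensorProduct.congr (.refl _ _) e) ≪≫ₗ
      TensorProduct.piScalarRight (MvPolynomial (Fin l) K) (MvPolynomial (Fin l) K)
        (residueModule K l) (Fin n)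
  have e2 := iso.toLinearEquiv ≪≫ₗ
    (show F.obj (P.complex.X i) ≃ₗ[MvPolynomial (Fin l) K] _ from e1)
  have e3 : ((ModuleCat.restrictScalars (algebraMap K (MvPolynomial (Fin l) K))).obj
      (((Tor (ModuleCat.{u} (MvPolynomial (Fin l) K)) i).obj
        (ModuleCat.of _ (residueModule K l))).obj (ModuleCat.of _ M))) ≃ₗ[K]
      (Fin n → residueModule K l) :=
    { toFun := e2
      invFun := e2.symm
      left_inv := e2.left_inv
      right_inv := e2.right_inv
      map_add' := e2.map_add
      map_smul' := by
        intro c x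
        refine (e2.map_smul (algebraMap K (MvPolynomial (Fin l) K) c) x).trans ?_
        exact algebraMap_smul (MvPolynomial (Fin l) K) c (e2 x) }
  have : Module.Finite K (residueModule K l) :=
    Module.finite_of_finrank_pos (by rw [finrank_residueModule]; norm_num)
  unfold totalBettiNumber
  rw [e3.finrank_eq, Module.finrank_pi_fintype]
  simp [finrank_residueModule]

end

noncomputable section

open CategoryTheory

universe u

/-! Let u be the product of the forms of the hyperplanes not containing X. Since K is infinite (all
that characteristic zero is used for), some p in X lies on none of these hyperplanes, so u does not
vanish at t • p for t ≠ 0. Write M for `S/J(A)` or `D(A)`, and N for the corresponding module of the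
localization `A_X`.

Three facts about the dimension of Tor_i against the residue field of a K-point (`pointBetti`) give
the inequality. M and N agree after inverting u, so they have the same value at t • p for t ≠ 0
(`pointBetti_eq_of_comp_eq_smul`). All hyperplanes of `A_X` contain p, so N is invariant under
translation by t • p and its value there is its value at the origin (`pointBetti_comp_algEquiv`).
For M the value at t • p is at most the value at the origin for all but finitely many t
(`finite_pointBetti_lt`).

The last two rest on `FiniteFreeResolution.pointBetti_add`, which expresses these dimensions through
ranks of the matrices of one resolution, evaluated at the point. -/

/-- A resolution of a module by free modules of finite rank, given by matrices. -/
structure FiniteFreeResolution (R : Type u) [CommRing R] (M : Type u) [AddCommGroup M]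
    [Module R M] where
  /-- the ranks of the free modules -/
  rank : ℕ → ℕ
  /-- the matrices of the differentials -/
  mat : ∀ k, Matrix (Fin (rank k)) (Fin (rank (k + 1))) R
  /-- the augmentation -/
  aug : (Fin (rank 0) → R) →ₗ[R] M
  aug_surjective : Function.Surjective aug
  exact_aug : Function.Exact (Matrix.mulVecLin (mat 0)) aug
  exact_mat : ∀ k, Function.Exact (Matrix.mulVecLin (mat (k + 1))) (Matrix.mulVecLin (mat k))

namespace FiniteFreeResolution

/-! ### Finite free resolutions over Noetherian rings -/

section Existence

variable {R : Type u} [CommRing R]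

theorem exists_matrix_range_eq {m : ℕ} {N : Submodule R (Fin m → R)} (hN : N.FG) :
    ∃ (k : ℕ) (D : Matrix (Fin m) (Fin k) R), LinearMap.range D.mulVecLin = N := by
  have : Module.Finite R N := Module.Finite.iff_fg.2 hN
  obtain ⟨k, f, hf⟩ := Module.Finite.exists_fin' R N
  refine ⟨k, LinearMap.toMatrix' (N.subtype ∘ₗ f), ?_⟩
  rw [← Matrix.toLin'_apply', Matrix.toLin'_toMatrix', LinearMap.range_comp,
    LinearMap.range_eq_top.2 hf, Submodule.map_top, Submodule.range_subtype]

theorem exists_exact_matrix [IsNoetherianRing R] {M : Type u} [AddCommGroup M] [Module R M]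
    {m : ℕ} (f : (Fin m → R) →ₗ[R] M) :
    ∃ (k : ℕ) (D : Matrix (Fin m) (Fin k) R), Function.Exact D.mulVecLin f := by
  obtain ⟨k, D, h⟩ := exists_matrix_range_eq (IsNoetherian.noetherian (LinearMap.ker f))
  exact ⟨k, D, LinearMap.exact_iff.2 h.symm⟩

/-- Successive syzygy matrices, starting with a given matrix. -/
def syzygyMatrix [IsNoetherianRing R] (D₀ : Σ m n : ℕ, Matrix (Fin m) (Fin n) R) :
    ℕ → Σ m n : ℕ, Matrix (Fin m) (Fin n) R
  | 0 => D₀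
  -- The row count is definitionally the previous column count, so consecutive matrices compose
  -- without casts.
  | k + 1 => ⟨(syzygyMatrix D₀ k).2.1,
      (exists_exact_matrix (syzygyMatrix D₀ k).2.2.mulVecLin).choose,
      (exists_exact_matrix (syzygyMatrix D₀ k).2.2.mulVecLin).choose_spec.choose⟩

theorem nonempty_of_finite [IsNoetherianRing R] (M : Type u) [AddCommGroup M] [Module R M]
    [Module.Finite R M] : Nonempty (FiniteFreeResolution R M) := by
  obtain ⟨m, f, hf⟩ := Module.Finite.exists_fin' R M
  obtain ⟨n, D, hD⟩ := exists_exact_matrix f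
  exact ⟨{
    rank := fun k => (syzygyMatrix ⟨m, n, D⟩ k).1
    mat := fun k => (syzygyMatrix ⟨m, n, D⟩ k).2.2
    aug := f
    aug_surjective := hf
    exact_aug := hD
    exact_mat := fun k =>
      (exists_exact_matrix (syzygyMatrix ⟨m, n, D⟩ k).2.2.mulVecLin).choose_spec.choose_spec }⟩

end Existence

/-! ### From matrices to a projective resolution -/

variable {R : Type u} [CommRing R] {M : Type u} [AddCommGroup M] [Module R M]
  (P : FiniteFreeResolution R M)

/-- The chain complex of a finite free resolution. -/
def complex : ChainComplex (ModuleCat.{u} R) ℕ :=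
  ChainComplex.of (fun k => ModuleCat.of R (Fin (P.rank k) → R))
    (fun k => ModuleCat.ofHom (P.mat k).mulVecLin)
    (fun k => by
      rw [← ModuleCat.ofHom_comp, (P.exact_mat k).linearMap_comp_eq_zero]
      rfl)

theorem complex_d (k : ℕ) :
    P.complex.d (k + 1) k = ModuleCat.ofHom (P.mat k).mulVecLin :=
  ChainComplex.of_d (V := ModuleCat.{u} R) (fun k => ModuleCat.of R (Fin (P.rank k) → R))
    (fun k => ModuleCat.ofHom (P.mat k).mulVecLin) k

theorem complex_d_comp_aug :
    P.complex.d 1 0 ≫ (ModuleCat.ofHom P.aug : P.complex.X 0 ⟶ ModuleCat.of R M) = 0 := by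
  rw [P.complex_d 0]
  exact ModuleCat.hom_ext P.exact_aug.linearMap_comp_eq_zero

/-- The augmentation as a morphism of complexes. -/
def π : P.complex ⟶ (ChainComplex.single₀ (ModuleCat.{u} R)).obj (ModuleCat.of R M) :=
  (P.complex.toSingle₀Equiv _).symm ⟨ModuleCat.ofHom P.aug, P.complex_d_comp_aug⟩

theorem quasiIso_π : QuasiIso P.π where
  quasiIsoAt k := by
    cases k with
    | zero =>
      rw [ChainComplex.quasiIsoAt₀_iff, ShortComplex.quasiIso_iff_of_zeros' _ rfl rfl rfl]
      constructor
      · rw [ShortComplex.moduleCat_exact_iff_range_eq_ker]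
        have h0 := P.complex_d 0
        have h := (LinearMap.exact_iff.1 P.exact_aug).symm
        simpa [π, ChainComplex.toSingle₀Equiv, h0] using! h
      · rw [ModuleCat.epi_iff_surjective]
        simpa [π, ChainComplex.toSingle₀Equiv] using! P.aug_surjective
    | succ k =>
      rw [quasiIsoAt_iff_exactAt' (hL := ChainComplex.exactAt_succ_single_obj ..),
        HomologicalComplex.exactAt_iff' _ (k + 2) (k + 1) k (by simp) (by simp),
        ShortComplex.moduleCat_exact_iff_range_eq_ker]
      have h0 := P.complex_d k
      have h1 := P.complex_d (k + 1)
      have h := (LinearMap.exact_iff.1 (P.exact_mat k)).symm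
      simpa [h0, h1] using! h

instance projective_complex (k : ℕ) : Projective (P.complex.X k) :=
  ModuleCat.projective_of_free (R := R) (M := ModuleCat.of R (Fin (P.rank k) → R))
    (Pi.basisFun R (Fin (P.rank k)))

/-- A finite free resolution as a projective resolution. -/
def toProjectiveResolution : ProjectiveResolution (ModuleCat.of R M) where
  complex := P.complex
  π := P.π
  quasiIso := P.quasiIso_π

end FiniteFreeResolution

/-- The dimension over `K` of the module underlying an object of `ModuleCat R`. -/
def scalarFinrank (K : Type u) {R : Type u} [Field K] [CommRing R] [Algebra K R]
    (V : ModuleCat.{u} R) : ℕ :=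
  Module.finrank K ((ModuleCat.restrictScalars (algebraMap K R)).obj V)

/-! ### Dimension count for homology over a field -/

section Homology

variable {K : Type u} [Field K]

/-- Homology is ker g modulo im f, and rank-nullity gives dim ker g; the additive form avoids
subtraction in ℕ. -/
theorem finrank_moduleCat_homology (T : ShortComplex (ModuleCat.{u} K))
    [Module.Finite K T.X₁] [Module.Finite K T.X₂] :
    Module.finrank K T.homology + Module.finrank K (LinearMap.range T.f.hom) +
      Module.finrank K (LinearMap.range T.g.hom) = Module.finrank K T.X₂ := by
  rw [T.moduleCatHomologyIso.toLinearEquiv.finrank_eq]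
  have h1 := LinearMap.finrank_range_add_finrank_ker T.g.hom
  have h2 := Submodule.finrank_quotient_add_finrank (LinearMap.range T.moduleCatToCycles)
  have h3 : Module.finrank K (LinearMap.range T.moduleCatToCycles) =
      Module.finrank K (LinearMap.range T.f.hom) := by
    have : LinearMap.range T.f.hom =
        (LinearMap.range T.moduleCatToCycles).map (LinearMap.ker T.g.hom).subtype := by
      rw [← LinearMap.range_comp]
      rfl
    rw [this]
    exact (LinearEquiv.finrank_eq (Submodule.equivMapOfInjective _
      (Submodule.subtype_injective _) _))
  have h4 : Module.finrank K T.moduleCatLeftHomologyData.H =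
    Module.finrank K (LinearMap.ker T.g.hom ⧸ LinearMap.range T.moduleCatToCycles) := rfl
  omega

theorem finrank_homology_add_rank_add_rank {a b c : ℕ} (T : ShortComplex (ModuleCat.{u} K))
    (e₁ : T.X₁ ≃ₗ[K] (Fin a → K)) (e₂ : T.X₂ ≃ₗ[K] (Fin b → K)) (e₃ : T.X₃ ≃ₗ[K] (Fin c → K))
    (A : Matrix (Fin b) (Fin a) K) (B : Matrix (Fin c) (Fin b) K)
    (hA : ∀ x, e₂ (T.f.hom x) = A.mulVec (e₁ x)) (hB : ∀ x, e₃ (T.g.hom x) = B.mulVec (e₂ x)) :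
    Module.finrank K T.homology + A.rank + B.rank = b := by
  have := Module.Finite.equiv e₁.symm
  have := Module.Finite.equiv e₂.symm
  have h := finrank_moduleCat_homology T
  have hf : (e₂ : T.X₂ →ₗ[K] _) ∘ₗ T.f.hom = A.mulVecLin ∘ₗ (e₁ : T.X₁ →ₗ[K] _) :=
    LinearMap.ext hA
  have hg : (e₃ : T.X₃ →ₗ[K] _) ∘ₗ T.g.hom = B.mulVecLin ∘ₗ (e₂ : T.X₂ →ₗ[K] _) :=
    LinearMap.ext hB
  have h1 : A.rank = Module.finrank K (LinearMap.range T.f.hom) := by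
    rw [Matrix.rank, ← LinearMap.range_comp_of_range_eq_top A.mulVecLin
      (LinearEquiv.range e₁), ← hf, LinearMap.range_comp]
    exact LinearEquiv.finrank_map_eq e₂ _
  have h2 : B.rank = Module.finrank K (LinearMap.range T.g.hom) := by
    rw [Matrix.rank, ← LinearMap.range_comp_of_range_eq_top B.mulVecLin
      (LinearEquiv.range e₂), ← hg, LinearMap.range_comp]
    exact LinearEquiv.finrank_map_eq e₃ _
  rw [h1, h2, h, e₂.finrank_eq, Module.finrank_fin_fun]

end Homology

/-! ### Tor against the residue field of a K-point -/

section Tor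

variable {K R : Type u} [Field K] [CommRing R] [Algebra K R]

/-- The residue module of a `K`-point of a `K`-algebra. -/
abbrev pointModule (φ : R →ₐ[K] K) : Type u := R ⧸ RingHom.ker φ

/-- Tensoring with the residue module of a point. -/
abbrev pointTensor (φ : R →ₐ[K] K) : ModuleCat.{u} R ⥤ ModuleCat.{u} R :=
  (MonoidalCategory.tensoringLeft (ModuleCat.{u} R)).obj (ModuleCat.of R (pointModule φ))

/-- The dimension of `Tor` against the residue module of a point. -/
def pointBetti (φ : R →ₐ[K] K) (M : Type u) [AddCommGroup M] [Module R M] (i : ℕ) : ℕ :=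
  scalarFinrank K (((Tor (ModuleCat.{u} R) i).obj
    (ModuleCat.of R (pointModule φ))).obj (ModuleCat.of R M))

theorem scalarFinrank_eq_of_iso {V W : ModuleCat.{u} R} (e : V ≅ W) :
    scalarFinrank K V = scalarFinrank K W :=
  ((ModuleCat.restrictScalars (algebraMap K R)).mapIso e).toLinearEquiv.finrank_eq

theorem point_surjective (φ : R →ₐ[K] K) : Function.Surjective φ :=
  fun c => ⟨algebraMap K R c, by simp⟩

open TensorProduct in
/-- The fibre of a finite free module at a point. -/
def pointTensorEquiv (φ : R →ₐ[K] K) (n : ℕ) :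
    pointModule φ ⊗[R] (Fin n → R) ≃ₗ[R] (Fin n → pointModule φ) :=
  TensorProduct.piScalarRight R R (pointModule φ) (Fin n)

/-- The fibre of a finite free module at a point as a vector space. -/
def pointFiberEquiv (φ : R →ₐ[K] K) (n : ℕ) :
    (ModuleCat.restrictScalars (algebraMap K R)).obj
      ((pointTensor φ).obj (ModuleCat.of R (Fin n → R))) ≃ₗ[K] (Fin n → K) where
  toFun x j := Ideal.quotientKerAlgEquivOfSurjective (point_surjective φ)
    (pointTensorEquiv φ n x j)
  invFun v := (pointTensorEquiv φ n).symm
    fun j => (Ideal.quotientKerAlgEquivOfSurjective (point_surjective φ)).symm (v j)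
  left_inv x := by
    simp only [AlgEquiv.symm_apply_apply]
    exact (pointTensorEquiv φ n).symm_apply_apply x
  right_inv v := by simp
  map_add' x y := by
    ext j
    have := congrFun ((pointTensorEquiv φ n).map_add x y) j
    exact (congrArg _ this).trans (map_add _ _ _)
  map_smul' c x := by
    ext j
    have := congrFun ((pointTensorEquiv φ n).map_smul (algebraMap K R c) x) j
    refine (congrArg (Ideal.quotientKerAlgEquivOfSurjective (point_surjective φ)) this).trans ?_
    rw [Pi.smul_apply, algebraMap_smul, map_smul]
    rfl

open TensorProduct in
theorem pointFiberEquiv_tmul (φ : R →ₐ[K] K) (n : ℕ) (r : R) (v : Fin n → R) :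
    pointFiberEquiv φ n ((Ideal.Quotient.mk (RingHom.ker φ) r : pointModule φ) ⊗ₜ[R] v) =
      fun j => φ r * φ (v j) := by
  ext j
  change Ideal.quotientKerAlgEquivOfSurjective (point_surjective φ)
    (pointTensorEquiv φ n ((Ideal.Quotient.mk (RingHom.ker φ) r : pointModule φ) ⊗ₜ[R] v) j) = _
  have : pointTensorEquiv φ n ((Ideal.Quotient.mk (RingHom.ker φ) r : pointModule φ) ⊗ₜ[R] v) j =
      Ideal.Quotient.mk (RingHom.ker φ) (v j * r) := by
    simp [pointTensorEquiv]
    rfl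
  rw [this, ← map_mul, mul_comm r]
  rfl

/-- Passing to the fibre at φ amounts to applying φ to the matrix entries. -/
theorem pointFiberEquiv_map (φ : R →ₐ[K] K) {m n : ℕ} (D : Matrix (Fin m) (Fin n) R)
    (x : (pointTensor φ).obj (ModuleCat.of R (Fin n → R))) :
    pointFiberEquiv φ m (((pointTensor φ).map (ModuleCat.ofHom D.mulVecLin)).hom x) =
      (D.map φ).mulVec (pointFiberEquiv φ n x) := by
  induction x using TensorProduct.induction_on with
  | zero =>
    rw [map_zero]
    erw [map_zero, map_zero]
    rw [Matrix.mulVec_zero]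
  | add x y hx hy =>
    rw [map_add]
    erw [map_add (pointFiberEquiv φ m), map_add (pointFiberEquiv φ n)]
    rw [Matrix.mulVec_add, ← hx, ← hy]
  | tmul r v =>
    obtain ⟨r, rfl⟩ := Ideal.Quotient.mk_surjective r
    refine (pointFiberEquiv_tmul φ m r (D.mulVec v)).trans ?_
    refine Eq.trans ?_ (congrArg (D.map φ).mulVec (pointFiberEquiv_tmul φ n r v).symm)
    ext j
    simp only [Matrix.mulVec, dotProduct, Matrix.map_apply, map_sum, map_mul, Finset.mul_sum]
    exact Finset.sum_congr rfl fun k _ => by ring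

variable {M : Type u} [AddCommGroup M] [Module R M]

/-- The rank at a point of the differential leaving degree `i` of a resolution. -/
def FiniteFreeResolution.pointRank (P : FiniteFreeResolution R M) (φ : R →ₐ[K] K) : ℕ → ℕ
  -- No differential leaves degree 0; this value makes `pointBetti_add` uniform in i.
  | 0 => 0
  | i + 1 => ((P.mat i).map φ).rank

/-- The rank of the i-th free module does not depend on φ, so the Betti number varies only through
the ranks of two evaluated matrices. -/
theorem FiniteFreeResolution.pointBetti_add (P : FiniteFreeResolution R M) (φ : R →ₐ[K] K)
    (i : ℕ) :
    pointBetti φ M i + P.pointRank φ (i + 1) + P.pointRank φ i = P.rank i := by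
  let G := ((pointTensor φ).mapHomologicalComplex _).obj P.complex
  have hd (k : ℕ) : G.d (k + 1) k =
      (pointTensor φ).map (ModuleCat.ofHom (P.mat k).mulVecLin) :=
    congrArg (pointTensor φ).map (P.complex_d k)
  -- The index c is i - 1 for i > 0; for i = 0 it is 0 itself, where the differential is zero.
  have h (c : ℕ) (hc : (ComplexShape.down ℕ).next i = c) :
      pointBetti φ M i = Module.finrank K
        ((G.sc' (i + 1) i c).map (ModuleCat.restrictScalars (algebraMap K R))).homology := by
    rw [((G.sc' (i + 1) i c).mapHomologyIso
      (ModuleCat.restrictScalars (algebraMap K R))).toLinearEquiv.finrank_eq]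
    exact scalarFinrank_eq_of_iso (P.toProjectiveResolution.isoLeftDerivedObj (pointTensor φ) i ≪≫
      ShortComplex.homologyMapIso (G.isoSc' (i + 1) i c (by simp) hc))
  have hA : ∀ x, pointFiberEquiv φ (P.rank i) ((G.d (i + 1) i).hom x) =
      ((P.mat i).map φ).mulVec (pointFiberEquiv φ (P.rank (i + 1)) x) := by
    intro x
    rw [hd]
    exact pointFiberEquiv_map φ (P.mat i) x
  cases i with
  | zero =>
    rw [h 0 (by simp)]
    have := finrank_homology_add_rank_add_rank
      ((G.sc' 1 0 0).map (ModuleCat.restrictScalars (algebraMap K R)))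
      (pointFiberEquiv φ (P.rank 1)) (pointFiberEquiv φ (P.rank 0)) (pointFiberEquiv φ (P.rank 0))
      ((P.mat 0).map φ) 0 hA (fun x => by
        have h0 : G.d 0 0 = 0 := G.shape 0 0 (by simp)
        change pointFiberEquiv φ (P.rank 0) ((G.d 0 0).hom x) = _
        rw [h0, Matrix.zero_mulVec]
        exact map_zero (pointFiberEquiv φ (P.rank 0)))
    rwa [Matrix.rank_zero] at this
  | succ j =>
    rw [h j (by simp)]
    exact finrank_homology_add_rank_add_rank
      ((G.sc' (j + 2) (j + 1) j).map (ModuleCat.restrictScalars (algebraMap K R)))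
      (pointFiberEquiv φ (P.rank (j + 2))) (pointFiberEquiv φ (P.rank (j + 1)))
      (pointFiberEquiv φ (P.rank j))
      ((P.mat (j + 1)).map φ) ((P.mat j).map φ) hA (fun x => by
        change pointFiberEquiv φ (P.rank j) ((G.d (j + 1) j).hom x) = _
        rw [hd]
        exact pointFiberEquiv_map φ (P.mat j) x)

end Tor

/-! ### Invariance under semilinear automorphisms -/

section Twist

variable {K R : Type u} [Field K] [CommRing R] [Algebra K R]
  {M : Type u} [AddCommGroup M] [Module R M]

theorem RingEquiv.exact_map_mulVec {m n k : ℕ} (σ : R ≃+* R) {A : Matrix (Fin m) (Fin n) R}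
    {B : Matrix (Fin k) (Fin m) R} (h : Function.Exact A.mulVec B.mulVec) :
    Function.Exact (A.map σ).mulVec (B.map σ).mulVec := by
  have key {a b : ℕ} (D : Matrix (Fin a) (Fin b) R) (v : Fin b → R) :
      σ ∘ D.mulVec v = (D.map σ).mulVec (σ ∘ v) :=
    funext fun j => RingHom.map_mulVec (σ : R →+* R) D v j
  intro v
  have hv : v = σ ∘ (σ.symm ∘ v) := by ext; simp
  rw [hv, ← key, Set.mem_range]
  have h0 : σ ∘ B.mulVec (σ.symm ∘ v) = 0 ↔ B.mulVec (σ.symm ∘ v) = 0 := by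
    simp only [funext_iff, Function.comp_apply, Pi.zero_apply, map_eq_zero_iff σ σ.injective]
  rw [h0, h]
  constructor
  · rintro ⟨w, hw⟩
    exact ⟨σ ∘ w, by rw [← key, hw]⟩
  · rintro ⟨w, hw⟩
    refine ⟨σ.symm ∘ w, ?_⟩
    have hw' : w = σ ∘ (σ.symm ∘ w) := by ext; simp
    rw [hw', ← key] at hw
    exact σ.injective.comp_left hw

/-- The twist of a finite free resolution by a semilinear automorphism. -/
def FiniteFreeResolution.twist (P : FiniteFreeResolution R M) (σ : R ≃+* R) (g : M ≃+ M)
    (hg : ∀ (r : R) (x : M), g (r • x) = σ r • g x) : FiniteFreeResolution R M where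
  rank := P.rank
  mat k := (P.mat k).map σ
  aug :=
    -- The σ-semilinearity of g cancels that of σ⁻¹ on coordinates, so the composite is R-linear.
    { toFun := fun v => g (P.aug (σ.symm ∘ v))
      map_add' := fun v w => by
        have : σ.symm ∘ (v + w) = σ.symm ∘ v + σ.symm ∘ w := by ext; simp
        rw [this, map_add, map_add]
      map_smul' := fun r v => by
        have : σ.symm ∘ (r • v) = σ.symm r • (σ.symm ∘ v) := by ext; simp
        rw [this, map_smul, hg, σ.apply_symm_apply, RingHom.id_apply] }
  aug_surjective x := by
    obtain ⟨v, hv⟩ := P.aug_surjective (g.symm x)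
    refine ⟨σ ∘ v, ?_⟩
    have : σ.symm ∘ (σ ∘ v) = v := by ext; simp
    simp [this, hv]
  exact_aug v := by
    have h := P.exact_aug (σ.symm ∘ v)
    have hv : v = σ ∘ (σ.symm ∘ v) := by ext; simp
    have key (w) : σ ∘ (P.mat 0).mulVec w = ((P.mat 0).map σ).mulVec (σ ∘ w) :=
      funext fun j => RingHom.map_mulVec (σ : R →+* R) (P.mat 0) w j
    change g _ = 0 ↔ _
    rw [map_eq_zero_iff g g.injective, h]
    constructor
    · rintro ⟨w, hw⟩
      exact ⟨σ ∘ w, by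
        rw [hv, ← hw]
        exact (key w).symm⟩
    · rintro ⟨w, hw⟩
      refine ⟨σ.symm ∘ w, σ.injective.comp_left ?_⟩
      have hw' : σ ∘ (σ.symm ∘ w) = w := by ext; simp
      dsimp only
      rw [← hv, ← hw, Matrix.mulVecLin_apply, key, hw', Matrix.mulVecLin_apply]
  exact_mat k := σ.exact_map_mulVec (P.exact_mat k)

/-- Evaluating the twisted resolution at φ gives the same matrices as evaluating the original at φ ∘
σ, and both resolve M. -/
theorem pointBetti_comp_algEquiv (P : FiniteFreeResolution R M) (φ : R →ₐ[K] K) (σ : R ≃ₐ[K] R)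
    (g : M ≃+ M) (hg : ∀ (r : R) (x : M), g (r • x) = σ r • g x) (i : ℕ) :
    pointBetti φ M i = pointBetti (φ.comp (σ : R →ₐ[K] R)) M i := by
  have h1 := (P.twist (σ : R ≃+* R) g hg).pointBetti_add φ i
  have h2 := P.pointBetti_add (φ.comp (σ : R →ₐ[K] R)) i
  have h (j : ℕ) : (P.twist (σ : R ≃+* R) g hg).pointRank φ j =
      P.pointRank (φ.comp (σ : R →ₐ[K] R)) j := by
    cases j <;> rfl
  have h3 : (P.twist (σ : R ≃+* R) g hg).rank i = P.rank i := rfl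
  rw [h, h, h3] at h1
  omega

end Twist

/-! ### Invariance under inverting an element -/

section Localization

variable {K R : Type u} [Field K] [CommRing R] [Algebra K R]

theorem pointTensor_map_smul (φ : R →ₐ[K] K) (r : R) (V : ModuleCat.{u} R) :
    (pointTensor φ).map (r • 𝟙 V) = algebraMap K R (φ r) • 𝟙 ((pointTensor φ).obj V) := by
  apply ModuleCat.hom_ext
  apply TensorProduct.ext'
  intro x y
  change x ⊗ₜ[R] (r • y) = algebraMap K R (φ r) • (x ⊗ₜ[R] y)
  rw [← TensorProduct.smul_tmul, TensorProduct.smul_tmul']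
  congr 1
  obtain ⟨x, rfl⟩ := Ideal.Quotient.mk_surjective x
  refine (Ideal.Quotient.eq (I := RingHom.ker φ)).2 ?_
  simp [RingHom.mem_ker]

/-- Multiplication by r lifts to r on a projective resolution, and r acts on the residue field as φ
r. -/
theorem leftDerived_pointTensor_map_smul (φ : R →ₐ[K] K) (r : R) (V : ModuleCat.{u} R) (i : ℕ) :
    ((pointTensor φ).leftDerived i).map (r • 𝟙 V) = algebraMap K R (φ r) • 𝟙 _ := by
  let P := projectiveResolution V
  rw [Functor.leftDerived_map_eq (pointTensor φ) i (r • 𝟙 V) (P := P) (Q := P)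
    (r • 𝟙 P.complex) (by
      apply HomologicalComplex.to_single_hom_ext
      simp only [HomologicalComplex.comp_f, HomologicalComplex.smul_f_apply,
        Linear.smul_comp, Category.id_comp,
        ChainComplex.single₀_map_f_zero]
      exact ((Linear.comp_smul _ _ _ _ _ _).trans (congrArg (r • ·) (Category.comp_id _))).symm)]
  have h : ((pointTensor φ).mapHomologicalComplex (ComplexShape.down ℕ)).map (r • 𝟙 P.complex) =
      algebraMap K R (φ r) • 𝟙 _ := by
    ext1 n
    exact pointTensor_map_smul φ r (P.complex.X n)
  have h2 : (HomologicalComplex.homologyFunctor (ModuleCat.{u} R) (ComplexShape.down ℕ) i).map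
      (algebraMap K R (φ r) • 𝟙 (((pointTensor φ).mapHomologicalComplex _).obj P.complex)) =
      algebraMap K R (φ r) • 𝟙 _ := by
    refine (ShortComplex.homologyMap_smul (𝟙 _) (algebraMap K R (φ r))).trans ?_
    rw [ShortComplex.homologyMap_id]
    rfl
  rw [Functor.comp_map, h, h2]
  simp

/-- Modules that agree after inverting an element have the same Betti numbers at the points where
that element does not vanish. -/
theorem pointBetti_eq_of_comp_eq_smul (φ : R →ₐ[K] K) {M N : Type u} [AddCommGroup M]
    [Module R M] [AddCommGroup N] [Module R N] (f : M →ₗ[R] N) (g : N →ₗ[R] M) {u : R}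
    (hu : φ u ≠ 0) (hgf : ∀ x, g (f x) = u • x) (hfg : ∀ y, f (g y) = u • y) (i : ℕ) :
    pointBetti φ M i = pointBetti φ N i := by
  let T := (pointTensor φ).leftDerived i
  let F : ModuleCat.of R M ⟶ ModuleCat.of R N := ModuleCat.ofHom f
  let G : ModuleCat.of R N ⟶ ModuleCat.of R M := ModuleCat.ofHom g
  have h1 : F ≫ G = u • 𝟙 _ := ModuleCat.hom_ext (LinearMap.ext hgf)
  have h2 : G ≫ F = u • 𝟙 _ := ModuleCat.hom_ext (LinearMap.ext hfg)
  have hc : algebraMap K R (φ u)⁻¹ * algebraMap K R (φ u) = 1 := by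
    rw [← map_mul, inv_mul_cancel₀ hu, map_one]
  -- On Tor both composites are the nonzero scalar φ u, so dividing by it produces an inverse.
  refine scalarFinrank_eq_of_iso (V := T.obj (ModuleCat.of R M)) (W := T.obj (ModuleCat.of R N))
    ⟨T.map F, algebraMap K R (φ u)⁻¹ • T.map G, ?_, ?_⟩
  · rw [Linear.comp_smul, ← T.map_comp, h1, leftDerived_pointTensor_map_smul, smul_smul, hc,
      one_smul]
  · rw [Linear.smul_comp, ← T.map_comp, h2, leftDerived_pointTensor_map_smul, smul_smul, hc,
      one_smul]

end Localization

/-! ### Semicontinuity along polynomial curves -/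

section Semicontinuity

variable {K : Type u} [Field K]

theorem Matrix.exists_mul_mul_eq_one {m n : ℕ} (A : Matrix (Fin m) (Fin n) K) :
    ∃ (B : Matrix (Fin A.rank) (Fin m) K) (C : Matrix (Fin n) (Fin A.rank) K),
      B * A * C = 1 := by
  let b : Module.Basis (Fin A.rank) K (LinearMap.range A.mulVecLin) := Module.finBasis K _
  have hb (j) : ∃ v, A.mulVecLin v = b j := (b j).2
  choose v hv using hb
  let f : (Fin A.rank → K) →ₗ[K] (Fin n → K) := Fintype.linearCombination K v
  have hf : Function.Injective (A.mulVecLin ∘ₗ f) := by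
    have : A.mulVecLin ∘ₗ f = (LinearMap.range A.mulVecLin).subtype ∘ₗ
        b.equivFun.symm.toLinearMap := by
      refine LinearMap.pi_ext' fun j => LinearMap.ext_ring ?_
      simp [f, Fintype.linearCombination_apply, hv, Pi.single_apply, Module.Basis.equivFun_symm_apply]
    rw [this]
    exact (Submodule.subtype_injective _).comp b.equivFun.symm.injective
  obtain ⟨h, hh⟩ := LinearMap.exists_leftInverse_of_injective _ (LinearMap.ker_eq_bot.2 hf)
  refine ⟨LinearMap.toMatrix' h, LinearMap.toMatrix' f, ?_⟩
  rw [Matrix.mul_assoc, ← LinearMap.toMatrix'_id, ← hh, LinearMap.toMatrix'_comp,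
    LinearMap.toMatrix'_comp, ← Matrix.toLin'_apply', LinearMap.toMatrix'_toLin']

open Polynomial in
/-- Lower semicontinuity of the rank of a matrix depending polynomially on a parameter. -/
theorem Matrix.finite_rank_eval_lt {m n : ℕ} (D : Matrix (Fin m) (Fin n) K[X]) (a : K) :
    {t : K | (D.map (eval t)).rank < (D.map (eval a)).rank}.Finite := by
  obtain ⟨B, C, h⟩ := (D.map (eval a)).exists_mul_mul_eq_one
  -- B and C are chosen at a and kept fixed, so d(a) = 1; wherever d(t) ≠ 0, the rank at t is at
  -- least the rank at a.
  let d : K[X] := (B.map Polynomial.C * D * C.map Polynomial.C).det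
  have hd (t : K) : d.eval t = (B * D.map (eval t) * C).det := by
    rw [← coe_evalRingHom, RingHom.map_det, RingHom.mapMatrix_apply, Matrix.map_mul,
      Matrix.map_mul, Matrix.map_map, Matrix.map_map]
    congr 3
    · ext; simp
    · ext; simp
  have hd0 : d ≠ 0 := by
    intro h0
    have := hd a
    rw [h, h0] at this
    simp at this
  refine (Polynomial.finite_setOfPred_isRoot hd0).subset fun t ht => ?_
  by_contra hroot
  have hunit : IsUnit (B * D.map (eval t) * C) := by
    rw [Matrix.isUnit_iff_isUnit_det, ← hd, isUnit_iff_ne_zero]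
    exact hroot
  have h1 := Matrix.rank_of_isUnit _ hunit
  rw [Fintype.card_fin] at h1
  have h2 := (Matrix.rank_mul_le_left (B * D.map (eval t)) C).trans
    (Matrix.rank_mul_le_right B (D.map (eval t)))
  have : (D.map (eval t)).rank < (D.map (eval a)).rank := ht
  omega

open Polynomial in
/-- Upper semicontinuity of Betti numbers along a polynomial curve. -/
theorem finite_pointBetti_lt {R : Type u} [CommRing R] [Algebra K R] {M : Type u}
    [AddCommGroup M] [Module R M] (P : FiniteFreeResolution R M) (ψ : R →ₐ[K] K[X]) (a : K)
    (i : ℕ) :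
    {t : K | pointBetti ((aeval a).comp ψ) M i < pointBetti ((aeval t).comp ψ) M i}.Finite := by
  have hr (j : ℕ) : {t : K | P.pointRank ((aeval t).comp ψ) j <
      P.pointRank ((aeval a).comp ψ) j}.Finite := by
    cases j with
    | zero => simp [FiniteFreeResolution.pointRank]
    | succ j =>
      have (t : K) : P.pointRank ((aeval t).comp ψ) (j + 1) =
          (((P.mat j).map ψ).map (eval t)).rank := by
        rw [FiniteFreeResolution.pointRank, Matrix.map_map]
        rfl
      simp only [this]
      exact Matrix.finite_rank_eval_lt _ a
  -- By `pointBetti_add`, a Betti number above its value at a forces one of the two ranks below its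
  -- value at a.
  refine ((hr i).union (hr (i + 1))).subset fun t ht => ?_
  have h1 := P.pointBetti_add ((aeval a).comp ψ) i
  have h2 := P.pointBetti_add ((aeval t).comp ψ) i
  simp only [Set.mem_union, Set.mem_ofPred_eq] at ht ⊢
  omega

end Semicontinuity

/-! ### Translations of affine space and the comparison criterion -/

section Translation

variable {K : Type u} [Field K] {l : ℕ}

/-- Translation by a vector, as an automorphism of the polynomial ring. -/
def MvPolynomial.translate (q : Fin l → K) :
    MvPolynomial (Fin l) K ≃ₐ[K] MvPolynomial (Fin l) K :=
  AlgEquiv.ofAlgHom (aeval fun i => X i + C (q i)) (aeval fun i => X i - C (q i))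
    (MvPolynomial.algHom_ext fun i => by simp [← MvPolynomial.algebraMap_eq])
    (MvPolynomial.algHom_ext fun i => by simp [← MvPolynomial.algebraMap_eq])

theorem MvPolynomial.translate_X (q : Fin l → K) (i : Fin l) :
    translate q (X i) = X i + C (q i) := by
  simp [translate]

theorem MvPolynomial.aeval_zero_comp_translate (q : Fin l → K) :
    (aeval (0 : Fin l → K)).comp (translate q : MvPolynomial (Fin l) K →ₐ[K] _) = aeval q :=
  MvPolynomial.algHom_ext fun i => by
    simp [translate_X, ← MvPolynomial.algebraMap_eq]

theorem MvPolynomial.translate_of_isHomogeneous_one (q : Fin l → K)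
    {α : MvPolynomial (Fin l) K} (hα : α.IsHomogeneous 1) :
    translate q α = α + C (eval q α) := by
  have hα' : α ∈ Submodule.span K (Set.range (X : Fin l → MvPolynomial (Fin l) K)) := by
    rw [← homogeneousSubmodule_one_eq_span_X]
    exact hα
  induction hα' using Submodule.span_induction with
  | mem _ h =>
    obtain ⟨i, rfl⟩ := h
    simp [translate_X]
  | zero => simp
  | add x y hx hy ihx ihy =>
    rw [← homogeneousSubmodule_one_eq_span_X] at hx hy
    rw [map_add, map_add, map_add, ihx hx, ihy hy]
    ring
  | smul c x hx ih =>
    rw [← homogeneousSubmodule_one_eq_span_X] at hx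
    rw [map_smul, ih hx, smul_add, smul_eval, C_mul, smul_eq_C_mul, smul_eq_C_mul]

/-- Conjugation of a derivation by an algebra automorphism. -/
def Derivation.conj {R : Type u} [CommRing R] [Algebra K R] (σ : R ≃ₐ[K] R)
    (δ : Derivation K R R) : Derivation K R R :=
  Derivation.mk' ((σ : R →ₐ[K] R).toLinearMap ∘ₗ (δ : R →ₗ[K] R) ∘ₗ
    (σ.symm : R →ₐ[K] R).toLinearMap) fun a b => by simp

theorem Derivation.conj_apply {R : Type u} [CommRing R] [Algebra K R] (σ : R ≃ₐ[K] R)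
    (δ : Derivation K R R) (a : R) : δ.conj σ a = σ (δ (σ.symm a)) := rfl

/-- The conjugate of a partial derivative by a translation is a derivation with the same values on
the variables. -/
theorem MvPolynomial.translate_pderiv (q : Fin l → K) (i : Fin l) (f : MvPolynomial (Fin l) K) :
    translate q (pderiv i f) = pderiv i (translate q f) := by
  have h : (pderiv i).conj (translate q) = pderiv i := by
    refine MvPolynomial.derivation_ext fun j => ?_
    have : (translate q).symm (X j) = X j - C (q j) := by simp [translate]
    rw [Derivation.conj_apply, this, map_sub, pderiv_C, sub_zero, pderiv_X, Pi.single_apply]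
    split_ifs <;> simp
  have := congrArg (fun δ => δ (translate q f)) h
  simpa [Derivation.conj_apply] using this

theorem MvPolynomial.ker_aeval_zero :
    RingHom.ker (aeval (0 : Fin l → K) : MvPolynomial (Fin l) K →ₐ[K] K) =
      Ideal.span (Set.range X) := by
  apply le_antisymm
  · have key (f : MvPolynomial (Fin l) K) : f - C (aeval (0 : Fin l → K) f) ∈
        Ideal.span (Set.range (X : Fin l → MvPolynomial (Fin l) K)) := by
      induction f using MvPolynomial.induction_on with
      | C a => simp
      | add p q hp hq =>
        rw [map_add, C_add, add_sub_add_comm]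
        exact Ideal.add_mem _ hp hq
      | mul_X p i _ =>
        simpa using Ideal.mul_mem_left _ p (Ideal.subset_span (Set.mem_range_self i))
    intro f hf
    have hf' := key f
    rwa [(RingHom.mem_ker).1 hf, C_0, sub_zero] at hf'
  · rw [Ideal.span_le]
    rintro _ ⟨i, rfl⟩
    simp [RingHom.mem_ker]

theorem totalBettiNumber_eq_pointBetti (M : Type u) [AddCommGroup M]
    [Module (MvPolynomial (Fin l) K) M] (i : ℕ) :
    totalBettiNumber K l M i = pointBetti (MvPolynomial.aeval (0 : Fin l → K)) M i := by
  -- The two descriptions of the ideal of the origin are only propositionally equal, so the ideal is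
  -- generalized before substitution.
  have h (I J : Ideal (MvPolynomial (Fin l) K)) (hIJ : I = J) :
      scalarFinrank K (((Tor (ModuleCat.{u} (MvPolynomial (Fin l) K)) i).obj
        (ModuleCat.of _ (MvPolynomial (Fin l) K ⧸ I))).obj (ModuleCat.of _ M)) =
      scalarFinrank K (((Tor (ModuleCat.{u} (MvPolynomial (Fin l) K)) i).obj
        (ModuleCat.of _ (MvPolynomial (Fin l) K ⧸ J))).obj (ModuleCat.of _ M)) := by
    subst hIJ
    rfl
  exact h _ _ MvPolynomial.ker_aeval_zero.symm

/-- If `N` is invariant under translation by the multiples of `p` and agrees with `M` after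
inverting an element that does not vanish at the nonzero multiples of `p`, then the total Betti
numbers of `N` are at most those of `M`. -/
theorem totalBettiNumber_le_of_translate [Infinite K] {M N : Type u} [AddCommGroup M]
    [Module (MvPolynomial (Fin l) K) M] [Module.Finite (MvPolynomial (Fin l) K) M]
    [AddCommGroup N] [Module (MvPolynomial (Fin l) K) N]
    [Module.Finite (MvPolynomial (Fin l) K) N]
    (f : M →ₗ[MvPolynomial (Fin l) K] N) (g : N →ₗ[MvPolynomial (Fin l) K] M)
    {u : MvPolynomial (Fin l) K} (hgf : ∀ x, g (f x) = u • x) (hfg : ∀ y, f (g y) = u • y)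
    (p : Fin l → K) (hu : ∀ t : K, t ≠ 0 → MvPolynomial.aeval (t • p) u ≠ 0)
    (hN : ∀ t : K, ∃ e : N ≃+ N, ∀ (r : MvPolynomial (Fin l) K) (x : N),
      e (r • x) = MvPolynomial.translate (t • p) r • e x) (i : ℕ) :
    totalBettiNumber K l N i ≤ totalBettiNumber K l M i := by
  obtain ⟨P⟩ := FiniteFreeResolution.nonempty_of_finite (R := MvPolynomial (Fin l) K) M
  obtain ⟨P'⟩ := FiniteFreeResolution.nonempty_of_finite (R := MvPolynomial (Fin l) K) N
  -- Restriction to the line t ↦ t • p.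
  let ψ : MvPolynomial (Fin l) K →ₐ[K] Polynomial K :=
    MvPolynomial.aeval fun j => Polynomial.X * Polynomial.C (p j)
  have hψ (t : K) : (Polynomial.aeval t).comp ψ = MvPolynomial.aeval (t • p) :=
    MvPolynomial.algHom_ext fun j => by simp [ψ, mul_comm t]
  obtain ⟨t, ht⟩ := ((finite_pointBetti_lt P ψ 0 i).insert 0).infinite_compl.nonempty
  simp only [Set.mem_compl_iff, Set.mem_insert_iff, Set.mem_ofPred_eq, not_or, not_lt, hψ,
    zero_smul] at ht
  obtain ⟨e, he⟩ := hN t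
  -- N at the origin is moved to N at t • p by translation, then to M at t • p by localization.
  rw [totalBettiNumber_eq_pointBetti, totalBettiNumber_eq_pointBetti,
    pointBetti_comp_algEquiv P' _ (MvPolynomial.translate (t • p)) e he,
    MvPolynomial.aeval_zero_comp_translate,
    ← pointBetti_eq_of_comp_eq_smul _ f g (hu t ht.1) hgf hfg]
  exact ht.2

end Translation

/-! ### Translation and localization of arrangements -/

namespace CentralArrangement

variable {K : Type u} [Field K] {l : ℕ}

section Translation

variable (A : CentralArrangement K l) {q : Fin l → K}

theorem translate_form {H : Submodule K (Fin l → K)} (hH : H ∈ A.hyperplanes) (hq : q ∈ H) :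
    MvPolynomial.translate q (A.form H) = A.form H := by
  rw [MvPolynomial.translate_of_isHomogeneous_one q (A.form_isHomogeneous H hH),
    (A.eval_form_eq_zero_iff H hH q).2 hq, MvPolynomial.C_0, add_zero]

/-- Translation by q fixes the defining polynomial and commutes with partial derivatives, so it
preserves the Jacobian ideal. -/
theorem exists_addEquiv_jacobian (hq : ∀ H ∈ A.hyperplanes, q ∈ H) :
    ∃ e : (MvPolynomial (Fin l) K ⧸ A.jacobianIdeal) ≃+ (MvPolynomial (Fin l) K ⧸ A.jacobianIdeal),
      ∀ (r : MvPolynomial (Fin l) K) (x : MvPolynomial (Fin l) K ⧸ A.jacobianIdeal),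
        e (r • x) = MvPolynomial.translate q r • e x := by
  have hQ : MvPolynomial.translate q A.definingPolynomial = A.definingPolynomial := by
    rw [definingPolynomial, map_prod]
    exact Finset.prod_congr rfl fun H hH => A.translate_form hH (hq H hH)
  have hJ : A.jacobianIdeal = A.jacobianIdeal.map
      ((MvPolynomial.translate q : MvPolynomial (Fin l) K ≃+* MvPolynomial (Fin l) K) :
        MvPolynomial (Fin l) K →+* MvPolynomial (Fin l) K) := by
    rw [jacobianIdeal, Ideal.map_span, Set.image_insert_eq, ← Set.range_comp]
    congr 2
    · exact hQ.symm
    · congr 1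
      ext1 i
      exact ((MvPolynomial.translate_pderiv q i _).trans (by rw [hQ])).symm
  refine ⟨(Ideal.quotientEquiv _ _ _ hJ).toAddEquiv, fun r x => ?_⟩
  obtain ⟨x, rfl⟩ := Ideal.Quotient.mk_surjective x
  exact map_mul (Ideal.quotientEquiv _ _ _ hJ) (Ideal.Quotient.mk _ r) (Ideal.Quotient.mk _ x)

theorem conj_mem_logDerivations
    (σ : MvPolynomial (Fin l) K ≃ₐ[K] MvPolynomial (Fin l) K)
    (hσ : ∀ H ∈ A.hyperplanes, σ (A.form H) = A.form H) {δ} (hδ : δ ∈ A.logDerivations) :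
    δ.conj σ ∈ A.logDerivations := by
  intro H hH
  rw [Derivation.conj_apply, (σ.symm_apply_eq).2 (hσ H hH).symm, Ideal.mem_span_singleton]
  have h := map_dvd σ (Ideal.mem_span_singleton.1 (hδ H hH))
  rwa [hσ H hH] at h

theorem exists_addEquiv_logDerivations (hq : ∀ H ∈ A.hyperplanes, q ∈ H) :
    ∃ e : A.logDerivations ≃+ A.logDerivations,
      ∀ (r : MvPolynomial (Fin l) K) (x : A.logDerivations),
        e (r • x) = MvPolynomial.translate q r • e x := by
  have hσ : ∀ H ∈ A.hyperplanes, MvPolynomial.translate q (A.form H) = A.form H :=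
    fun H hH => A.translate_form hH (hq H hH)
  have hσ' : ∀ H ∈ A.hyperplanes, (MvPolynomial.translate q).symm (A.form H) = A.form H :=
    fun H hH => ((MvPolynomial.translate q).symm_apply_eq).2 (hσ H hH).symm
  refine ⟨{
    toFun := fun δ => ⟨_, A.conj_mem_logDerivations _ hσ δ.2⟩
    invFun := fun δ => ⟨_, A.conj_mem_logDerivations _ hσ' δ.2⟩
    left_inv := fun δ => Subtype.ext (Derivation.ext fun a => by simp [Derivation.conj_apply])
    right_inv := fun δ => Subtype.ext (Derivation.ext fun a => by simp [Derivation.conj_apply])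
    map_add' := fun δ ε => Subtype.ext (Derivation.ext fun a => by
      simp [Derivation.conj_apply]) }, fun r δ => Subtype.ext (Derivation.ext fun a => by
      simp [Derivation.conj_apply])⟩

end Translation

/-- A derivation is determined by its values on the variables, which embeds the module in a
Noetherian free module. -/
theorem finite_logDerivations (A : CentralArrangement K l) :
    Module.Finite (MvPolynomial (Fin l) K) A.logDerivations := by
  let ev : Derivation K (MvPolynomial (Fin l) K) (MvPolynomial (Fin l) K)
      →ₗ[MvPolynomial (Fin l) K] (Fin l → MvPolynomial (Fin l) K) :=
    { toFun := fun δ j => δ (MvPolynomial.X j)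
      map_add' := fun _ _ => rfl
      map_smul' := fun _ _ => rfl }
  exact Module.Finite.of_injective (ev ∘ₗ A.logDerivations.subtype) fun δ ε h =>
    Subtype.ext (MvPolynomial.derivation_ext fun j => congrFun h j)

section Localization

variable (A : CentralArrangement K l) (X : Submodule K (Fin l → K))

theorem mem_hyperplanes_localization {H : Submodule K (Fin l → K)} :
    H ∈ (A.localization X).hyperplanes ↔ H ∈ A.hyperplanes ∧ X ≤ H := by
  classical
  exact Finset.mem_filter

open Classical in
/-- The product of the defining forms of the hyperplanes that do not contain `X`. -/
def complementPolynomial : MvPolynomial (Fin l) K :=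
  ∏ H ∈ A.hyperplanes.filter (fun H => ¬ X ≤ H), A.form H

theorem definingPolynomial_localization_mul :
    (A.localization X).definingPolynomial * A.complementPolynomial X = A.definingPolynomial := by
  classical
  exact Finset.prod_filter_mul_prod_filter_not _ _ _

/-- Each H not containing X cuts X in a proper subspace, and finitely many proper subspaces do not
cover X over an infinite field. -/
theorem exists_mem_eval_complementPolynomial_ne_zero [Infinite K] :
    ∃ p ∈ X, ∀ t : K, t ≠ 0 → MvPolynomial.aeval (t • p) (A.complementPolynomial X) ≠ 0 := by
  classical
  let ι := {H // H ∈ A.hyperplanes.filter (fun H => ¬ X ≤ H)}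
  obtain ⟨p, hp⟩ := Submodule.exists_forall_notMem_of_forall_ne_top
    (fun H : ι => H.1.comap X.subtype) (fun H h => by
      rw [Submodule.comap_subtype_eq_top] at h
      exact (Finset.mem_filter.1 H.2).2 h)
  refine ⟨p, p.2, fun t ht => ?_⟩
  rw [complementPolynomial, map_prod, Finset.prod_ne_zero_iff]
  intro H hH h0
  have := (A.eval_form_eq_zero_iff H (Finset.mem_filter.1 hH).1 (t • (p : Fin l → K))).1 h0
  exact hp ⟨H, hH⟩ ((Submodule.smul_mem_iff H ht).1 this)

theorem logDerivations_le_localization :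
    A.logDerivations ≤ (A.localization X).logDerivations :=
  fun _ hδ H hH => hδ H ((A.mem_hyperplanes_localization X).1 hH).1

theorem complementPolynomial_smul_mem {δ} (hδ : δ ∈ (A.localization X).logDerivations) :
    A.complementPolynomial X • δ ∈ A.logDerivations := by
  classical
  intro H hH
  rw [Derivation.smul_apply, smul_eq_mul]
  by_cases h : X ≤ H
  · exact Ideal.mul_mem_left _ _ (hδ H ((A.mem_hyperplanes_localization X).2 ⟨hH, h⟩))
  · exact Ideal.mul_mem_right _ _ (Ideal.mem_span_singleton.2
      (Finset.dvd_prod_of_mem _ (Finset.mem_filter.2 ⟨hH, h⟩)))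

theorem jacobianIdeal_le_localization :
    A.jacobianIdeal ≤ (A.localization X).jacobianIdeal := by
  have hQ : (A.localization X).definingPolynomial ∈ (A.localization X).jacobianIdeal :=
    Ideal.subset_span (Set.mem_insert _ _)
  have hd (i) : MvPolynomial.pderiv i (A.localization X).definingPolynomial ∈
      (A.localization X).jacobianIdeal :=
    Ideal.subset_span (Set.mem_insert_of_mem _ ⟨i, rfl⟩)
  rw [jacobianIdeal, Ideal.span_le, ← A.definingPolynomial_localization_mul X]
  rintro _ (rfl | ⟨i, rfl⟩)
  · exact Ideal.mul_mem_right _ _ hQ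
  · dsimp only
    rw [Derivation.leibniz]
    exact Ideal.add_mem _ (Ideal.mul_mem_right _ _ hQ) (Ideal.mul_mem_left _ _ (hd i))

/-- With Q(A) = Q u, the product rule gives u ∂Q = ∂Q(A) - Q ∂u. A second factor u turns Q ∂u into a
multiple of Q(A), hence the square. -/
theorem complementPolynomial_sq_mul_mem {f} (hf : f ∈ (A.localization X).jacobianIdeal) :
    A.complementPolynomial X ^ 2 * f ∈ A.jacobianIdeal := by
  have hQ : A.definingPolynomial ∈ A.jacobianIdeal := Ideal.subset_span (Set.mem_insert _ _)
  have hd (i) : MvPolynomial.pderiv i A.definingPolynomial ∈ A.jacobianIdeal :=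
    Ideal.subset_span (Set.mem_insert_of_mem _ ⟨i, rfl⟩)
  have hle : (A.localization X).jacobianIdeal ≤
      Submodule.comap (LinearMap.lsmul (MvPolynomial (Fin l) K) (MvPolynomial (Fin l) K)
        (A.complementPolynomial X ^ 2)) A.jacobianIdeal := by
    have h := A.definingPolynomial_localization_mul X
    set u := A.complementPolynomial X
    set Q := (A.localization X).definingPolynomial with hQdef
    rw [jacobianIdeal, ← hQdef]
    refine Submodule.span_le.2 ?_
    rintro _ (rfl | ⟨i, rfl⟩)
    · change u ^ 2 * Q ∈ A.jacobianIdeal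
      have : u ^ 2 * Q = u * A.definingPolynomial := by rw [← h]; ring
      rw [this]
      exact Ideal.mul_mem_left _ _ hQ
    · change u ^ 2 * MvPolynomial.pderiv i Q ∈ A.jacobianIdeal
      have : u ^ 2 * MvPolynomial.pderiv i Q =
          u * MvPolynomial.pderiv i A.definingPolynomial -
            MvPolynomial.pderiv i u * A.definingPolynomial := by
        rw [← h, Derivation.leibniz, smul_eq_mul, smul_eq_mul]
        ring
      rw [this]
      exact Ideal.sub_mem _ (Ideal.mul_mem_left _ _ (hd i)) (Ideal.mul_mem_left _ _ hQ)
  exact hle hf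

end Localization

end CentralArrangement

end

/-! ### The inequalities for both modules -/

theorem proposition5p1 {K : Type*} [Field K] [CharZero K] {l : ℕ}
    (A : CentralArrangement K l) (X : Submodule K (Fin l → K)) (hX : X ∈ A.flats) (i : ℕ) :
    totalBettiNumber K l (MvPolynomial (Fin l) K ⧸ (A.localization X).jacobianIdeal) i ≤
        totalBettiNumber K l (MvPolynomial (Fin l) K ⧸ A.jacobianIdeal) i ∧
      totalBettiNumber K l (A.localization X).logDerivations i ≤
        totalBettiNumber K l A.logDerivations i := by
  have := A.finite_logDerivations
  have := (A.localization X).finite_logDerivations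
  obtain ⟨p, hp, hu⟩ := A.exists_mem_eval_complementPolynomial_ne_zero X
  have hq (t : K) : ∀ H ∈ (A.localization X).hyperplanes, t • p ∈ H :=
    fun H hH => H.smul_mem t (((A.mem_hyperplanes_localization X).1 hH).2 hp)
  constructor
  -- The quotient map and multiplication by u² compose to u² both ways.
  · refine totalBettiNumber_le_of_translate
      (Submodule.mapQ A.jacobianIdeal (A.localization X).jacobianIdeal LinearMap.id
        (A.jacobianIdeal_le_localization X))
      (Submodule.mapQ (A.localization X).jacobianIdeal A.jacobianIdeal
        (LinearMap.lsmul _ (MvPolynomial (Fin l) K) (A.complementPolynomial X ^ 2))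
        fun f hf => A.complementPolynomial_sq_mul_mem X hf)
      (u := A.complementPolynomial X ^ 2) ?_ ?_ p ?_
      (fun t => (A.localization X).exists_addEquiv_jacobian (hq t)) i
    · intro x
      obtain ⟨x, rfl⟩ := Submodule.Quotient.mk_surjective _ x
      rfl
    · intro x
      obtain ⟨x, rfl⟩ := Submodule.Quotient.mk_surjective _ x
      rfl
    · intro t ht
      rw [map_pow]
      exact pow_ne_zero 2 (hu t ht)
  -- Here inclusion and multiplication by u itself suffice.
  · exact totalBettiNumber_le_of_translate
      (Submodule.inclusion (A.logDerivations_le_localization X))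
      ((LinearMap.lsmul _ _ (A.complementPolynomial X)).restrict
        fun δ hδ => A.complementPolynomial_smul_mem X hδ)
      (fun _ => rfl) (fun _ => rfl) p hu
      (fun t => (A.localization X).exists_addEquiv_logDerivations (hq t)) i
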